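/- Let $2\le N\le d$ be integers and regard $\Lambda^N\mathbb{C}^d$ as the antisymmetric subspace of $(\mathbb{C}^d)^{\otimes N}$. Let $\Psi_N\in\Lambda^N\mathbb{C}^d$ be a unit vector. For $k\in\{1,2\}$ let $\gamma_k:=\mathrm{Tr}_{k+1,\dots,N}\,|\Psi_N\rangle\langle\Psi_N|$ be its $k$-body reduced density matrix, that is, the (trace-preserving) partial trace over the last $N-k$ tensor factors of $(\mathbb{C}^d)^{\otimes N}=(\mathbb{C}^d)^{\otimes k}\otimes(\mathbb{C}^d)^{\otimes(N-k)}$, so that $\mathrm{Tr}\,\gamma_k=1$. Let $S(\gamma):=-\mathrm{Tr}[\gamma\log\gamma]$ denote the von Neumann entropy (natural logarithm, $0\log 0=0$). Then $$S(\gamma_2)\;\ge\;S(\gamma_1)+\log\left(\frac{N-1}{d-N+2}\right).$$ -/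

import Mathlib

noncomputable section

namespace Fermion

/-- The `N`-particle space `(ℂ^d)^{⊗N}` with its Hilbert space structure, in the orthonormal
product basis `e_{i 0} ⊗ ⋯ ⊗ e_{i (N-1)}`, indexed by `i : Fin N → Fin d`. -/
abbrev TensorSpace (d N : ℕ) : Type := EuclideanSpace ℂ (Fin N → Fin d)

/-- Matrices (operators) on `(ℂ^d)^{⊗N}`, in the product basis. -/
abbrev TensorMatrix (d N : ℕ) : Type := Matrix (Fin N → Fin d) (Fin N → Fin d) ℂ

/-- The antisymmetric subspace `Λ^N ℂ^d ⊆ (ℂ^d)^{⊗N}`: the tensors that are multiplied by the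
sign of the permutation when the `N` tensor factors are permuted. -/
def antisymmetricSubspace (d N : ℕ) : Submodule ℂ (TensorSpace d N) where
  carrier := {Ψ | ∀ (σ : Equiv.Perm (Fin N)) (i : Fin N → Fin d),
    Ψ (fun p => i (σ p)) = ((Equiv.Perm.sign σ : ℤ) : ℂ) * Ψ i}
  add_mem' := by
    intro Ψ Φ hΨ hΦ σ i
    simp only [PiLp.add_apply, hΨ σ i, hΦ σ i, mul_add]
  zero_mem' := by
    intro σ i
    simp
  smul_mem' := by
    intro c Ψ hΨ σ i
    simp only [PiLp.smul_apply, smul_eq_mul, hΨ σ i]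
    ring

/-- The rank-one matrix `|Ψ⟩⟨Ψ|`. -/
def ketBra {d N : ℕ} (Ψ : TensorSpace d N) : TensorMatrix d N :=
  Matrix.of fun i j => Ψ i * star (Ψ j)

/-- The multi-index on `N` factors with first `k` entries `a` and last `N - k` entries `c`;
it expresses `(ℂ^d)^{⊗N} = (ℂ^d)^{⊗k} ⊗ (ℂ^d)^{⊗(N-k)}` on basis vectors. -/
def joinIndex {d N k : ℕ} (hk : k ≤ N) (a : Fin k → Fin d) (c : Fin (N - k) → Fin d) :
    Fin N → Fin d :=
  fun p => Fin.append a c (Fin.cast (Nat.add_sub_of_le hk).symm p)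

/-- The partial trace `Tr_{k+1,…,N}` over the last `N - k` tensor factors. -/
def partialTrace {d N : ℕ} (k : ℕ) (hk : k ≤ N) (ρ : TensorMatrix d N) : TensorMatrix d k :=
  Matrix.of fun a b => ∑ c : Fin (N - k) → Fin d, ρ (joinIndex hk a c) (joinIndex hk b c)

/-- The `k`-body reduced density matrix `γ_k = Tr_{k+1,…,N} |Ψ⟩⟨Ψ|`
(trace one when `Ψ` is a unit vector). -/
def reducedDensityMatrix {d N : ℕ} (k : ℕ) (hk : k ≤ N) (Ψ : TensorSpace d N) :
    TensorMatrix d k :=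
  partialTrace k hk (ketBra Ψ)

/-- The von Neumann entropy `S(γ) = -Tr[γ log γ]` (natural logarithm) of a density matrix `γ`.
The matrix logarithm is given by the functional calculus for self-adjoint matrices; since
`Real.log 0 = 0`, the usual convention `0 log 0 = 0` is in force. -/
def vonNeumannEntropy {n : Type*} [Fintype n] [DecidableEq n] (γ : Matrix n n ℂ) : ℝ :=
  -(Matrix.trace (γ * cfc Real.log γ)).re

end Fermion

end

/-! Put M = N - 2 and C = (d - M) / (M + 1) = (d - N + 2) / (N - 1). The claim follows from the
operator inequality γ₂ ≤ C γ₁ ⊗ 1: monotonicity of log gives Tr γ₂ log γ₂ ≤ Tr γ₂ log (C γ₁ ⊗ 1),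
and since the partial trace of γ₂ is γ₁ and Tr γ₁ = 1, the right side is log C + Tr γ₁ log γ₁.

The operator inequality (`sum_norm_sq_sum_contractFirst_le`) is Pauli exclusion used twice. Given M
occupied modes, only d - M modes are free for one more particle, so Cauchy–Schwarz costs d - M. In
an antisymmetric function of M + 1 variables, a given mode occupies a given slot with at most 1 / (M
+ 1) of the total mass.

Only a weak form of log monotonicity is needed, tested on eigenvectors of the smaller operator
(`sum_mul_log_le_of_le`). Operators enter through their quadratic forms, written in eigenbases. -/

open scoped InnerProductSpace

namespace Fermion

/-! ### Monotonicity of the logarithm under the trace. -/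

section EntropyComparison

variable {E ι κ : Type*} [NormedAddCommGroup E] [InnerProductSpace ℂ E] [Fintype ι] [Fintype κ]

/-- If a unit vector `u` satisfies `t |u⟩⟨u| ≤ ∑ j, μ j |v j⟩⟨v j|` with `t > 0`, then
`log t ≤ ∑ j, |⟨v j, u⟩|² log (μ j)`. -/
theorem log_le_sum_log_of_rankOne_le (v : OrthonormalBasis κ ℂ E) (μ : κ → ℝ)
    (hμ : ∀ j, 0 ≤ μ j) (u : E) (hu : ‖u‖ = 1) (t : ℝ) (ht : 0 < t)
    (h : ∀ w : E, t * ‖⟪u, w⟫_ℂ‖ ^ 2 ≤ ∑ j, μ j * ‖⟪v j, w⟫_ℂ‖ ^ 2) :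
    Real.log t ≤ ∑ j, ‖⟪v j, u⟫_ℂ‖ ^ 2 * Real.log (μ j) := by
  classical
  have hsum : ∑ j, ‖⟪v j, u⟫_ℂ‖ ^ 2 = 1 := by
    rw [v.sum_sq_norm_inner_right, hu, one_pow]
  -- Testing at `v j` shows that `u` is orthogonal to the kernel of the larger operator; otherwise
  -- `Real.log 0 = 0` would spoil the bound.
  have hker : ∀ j, μ j = 0 → ‖⟪v j, u⟫_ℂ‖ ^ 2 = 0 := by
    intro j hj
    have h1 := h (v j)
    have h2 : ∑ k, μ k * ‖⟪v k, v j⟫_ℂ‖ ^ 2 = 0 := by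
      refine Finset.sum_eq_zero fun k _ => ?_
      rw [v.inner_eq_ite]
      split_ifs with hk
      · simp [hk, hj]
      · simp
    rw [h2, norm_inner_symm] at h1
    nlinarith [sq_nonneg ‖⟪v j, u⟫_ℂ‖]
  set s : ℝ := ∑ j, ‖⟪v j, u⟫_ℂ‖ ^ 2 * (μ j)⁻¹ with hs
  have hs0 : 0 ≤ s := Finset.sum_nonneg fun j _ => mul_nonneg (sq_nonneg _) (inv_nonneg.2 (hμ j))
  have hts : t * s ≤ 1 := by
    -- With B = ∑ j, μ j |v j⟩⟨v j|, this is B⁻¹u, a pseudo-inverse because `0⁻¹ = 0`. The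
    -- hypothesis at `w` reads t s² ≤ s.
    let w : E := ∑ j, (⟪v j, u⟫_ℂ * ((μ j)⁻¹ : ℝ)) • v j
    have hvw : ∀ j, ⟪v j, w⟫_ℂ = ⟪v j, u⟫_ℂ * ((μ j)⁻¹ : ℝ) := fun j =>
      v.orthonormal.inner_right_fintype _ j
    have huw : ⟪u, w⟫_ℂ = (s : ℂ) := by
      simp only [w, inner_sum, inner_smul_right, hs, Complex.ofReal_sum]
      refine Finset.sum_congr rfl fun j _ => ?_
      rw [← inner_conj_symm u (v j), mul_right_comm, Complex.mul_conj, Complex.normSq_eq_norm_sq]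
      push_cast
      ring
    have hw := h w
    have hR : ∑ j, μ j * ‖⟪v j, w⟫_ℂ‖ ^ 2 = s := by
      refine Finset.sum_congr rfl fun j _ => ?_
      rw [hvw, norm_mul, Complex.norm_real, Real.norm_of_nonneg (inv_nonneg.2 (hμ j))]
      rcases eq_or_ne (μ j) 0 with hj | hj
      · simp [hj]
      · field_simp
    rw [hR, huw, Complex.norm_real, Real.norm_of_nonneg hs0] at hw
    rcases hs0.eq_or_lt with h0 | h0
    · rw [← h0]; simp
    · nlinarith
  -- This is log y ≤ y - 1 at y = t / μ j, weighted; summed over j, the right side is t s - 1 ≤ 0.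
  have hlog : ∀ j, ‖⟪v j, u⟫_ℂ‖ ^ 2 * (Real.log t - Real.log (μ j)) ≤
      t * (‖⟪v j, u⟫_ℂ‖ ^ 2 * (μ j)⁻¹) - ‖⟪v j, u⟫_ℂ‖ ^ 2 := by
    intro j
    rcases (hμ j).eq_or_lt with hj | hj
    · simp [hker j hj.symm]
    · have := Real.log_le_sub_one_of_pos (div_pos ht hj)
      rw [Real.log_div ht.ne' hj.ne'] at this
      calc _ ≤ ‖⟪v j, u⟫_ℂ‖ ^ 2 * (t / μ j - 1) := mul_le_mul_of_nonneg_left this (sq_nonneg _)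
        _ = _ := by ring
  have := Finset.sum_le_sum fun j (_ : j ∈ Finset.univ) => hlog j
  simp only [mul_sub, Finset.sum_sub_distrib, ← Finset.mul_sum, ← Finset.sum_mul, hsum] at this
  linarith

/-- Comparison of `Tr A log A` with `Tr A log B` for positive operators `A ≤ B` on a
finite-dimensional space, given by spectral decompositions `A = ∑ i, a i |u i⟩⟨u i|` and
`B = ∑ j, μ j |v j⟩⟨v j|`. -/
theorem sum_mul_log_le_of_le (u : OrthonormalBasis ι ℂ E) (a : ι → ℝ) (ha : ∀ i, 0 ≤ a i)
    (v : OrthonormalBasis κ ℂ E) (μ : κ → ℝ) (hμ : ∀ j, 0 ≤ μ j)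
    (h : ∀ w : E, ∑ i, a i * ‖⟪u i, w⟫_ℂ‖ ^ 2 ≤ ∑ j, μ j * ‖⟪v j, w⟫_ℂ‖ ^ 2) :
    ∑ i, a i * Real.log (a i) ≤
      ∑ j, (∑ i, a i * ‖⟪u i, v j⟫_ℂ‖ ^ 2) * Real.log (μ j) := by
  simp only [Finset.sum_mul, mul_assoc]
  rw [Finset.sum_comm]
  refine Finset.sum_le_sum fun i _ => ?_
  rw [← Finset.mul_sum]
  rcases (ha i).eq_or_lt with hi | hi
  · simp [← hi]
  · refine mul_le_mul_of_nonneg_left ?_ hi.le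
    rw [Finset.sum_congr rfl fun j _ => by rw [norm_inner_symm (u i) (v j)]]
    refine log_le_sum_log_of_rankOne_le v μ hμ (u i) (u.norm_eq_one i) (a i) hi fun w => ?_
    exact (Finset.single_le_sum (f := fun i => a i * ‖⟪u i, w⟫_ℂ‖ ^ 2)
      (fun k _ => mul_nonneg (ha k) (sq_nonneg _)) (Finset.mem_univ i)).trans (h w)

end EntropyComparison

/-! ### Entropy and quadratic forms through eigenvalues. -/

section Spectral

variable {n : Type*} [Fintype n] [DecidableEq n] {A : Matrix n n ℂ}

theorem vonNeumannEntropy_eq_sum_eigenvalues (hA : A.IsHermitian) :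
    vonNeumannEntropy A = -∑ i, hA.eigenvalues i * Real.log (hA.eigenvalues i) := by
  have hsa : IsSelfAdjoint A := hA
  have h1 : A * cfc Real.log A = cfc (fun x : ℝ => x * Real.log x) A := by
    rw [cfc_mul (fun x : ℝ => x) Real.log A (by fun_prop)
      (Matrix.finite_real_spectrum.continuousOn _), cfc_id' ℝ A]
  rw [vonNeumannEntropy, h1, hA.cfc_eq, Matrix.IsHermitian.cfc, Unitary.conjStarAlgAut_apply,
    Matrix.trace_mul_comm, ← mul_assoc]
  simp [Matrix.trace_diagonal, Function.comp_def]

theorem sum_eigenvalues_mul_norm_inner_sq (hA : A.IsHermitian) (w : EuclideanSpace ℂ n) :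
    ((∑ i, hA.eigenvalues i * ‖⟪hA.eigenvectorBasis i, w⟫_ℂ‖ ^ 2 : ℝ) : ℂ) =
      ∑ a, ∑ b, star (w a) * A a b * w b := by
  have h1 : ∑ a, ∑ b, star (w a) * A a b * w b = ⟪w, Matrix.toEuclideanLin A w⟫_ℂ := by
    simp only [PiLp.inner_apply, Matrix.toLpLin_apply, Matrix.mulVec, dotProduct,
      RCLike.inner_apply, Finset.sum_mul]
    refine Finset.sum_congr rfl fun a _ => Finset.sum_congr rfl fun b _ => ?_
    simp only [starRingEnd_apply]
    ring
  rw [h1, ← hA.eigenvectorBasis.sum_inner_mul_inner, Complex.ofReal_sum]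
  refine Finset.sum_congr rfl fun i _ => ?_
  have h2 : Matrix.toEuclideanLin A (hA.eigenvectorBasis i) =
      (hA.eigenvalues i : ℂ) • hA.eigenvectorBasis i := by
    ext a
    have := congrFun (hA.mulVec_eigenvectorBasis i) a
    simpa [Matrix.toLpLin_apply] using this
  rw [← (Matrix.isSymmetric_toEuclideanLin_iff.mpr hA) (hA.eigenvectorBasis i) w, h2,
    inner_smul_left, Complex.conj_ofReal, ← inner_conj_symm w, mul_left_comm, mul_comm _ ⟪_, w⟫_ℂ,
    Complex.mul_conj, Complex.normSq_eq_norm_sq]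
  push_cast
  ring

end Spectral

/-! ### Pauli exclusion and counting of free modes. -/

section AntisymmetricFunctions

variable {d M : ℕ}

theorem eq_zero_of_not_injective {N : ℕ} {Ψ : TensorSpace d N}
    (hΨ : Ψ ∈ antisymmetricSubspace d N) {p : Fin N → Fin d} (hp : ¬ Function.Injective p) :
    Ψ p = 0 := by
  simp only [Function.Injective, not_forall] at hp
  obtain ⟨x, y, hxy, hne⟩ := hp
  have h := hΨ (Equiv.swap x y) p
  have hpp : (fun q => p (Equiv.swap x y q)) = p := by
    funext q
    rcases eq_or_ne q x with rfl | hx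
    · simp [hxy]
    · rcases eq_or_ne q y with rfl | hy
      · simp [hxy]
      · rw [Equiv.swap_apply_of_ne_of_ne hx hy]
  rw [hpp, Equiv.Perm.sign_swap hne] at h
  simp only [Units.val_neg, Units.val_one, Int.cast_neg, Int.cast_one, neg_mul, one_mul] at h
  exact self_eq_neg.mp h

/-- Contraction of the first index of `Ψ` with a vector. -/
def contractFirst (Ψ : TensorSpace d (M + 1)) (x : Fin d → ℂ) (p : Fin M → Fin d) : ℂ :=
  ∑ j, star (x j) * Ψ (Fin.cons j p)

theorem contractFirst_eq_zero_of_not_injective {Ψ : TensorSpace d (M + 1)}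
    (hΨ : Ψ ∈ antisymmetricSubspace d (M + 1)) (x : Fin d → ℂ) {p : Fin M → Fin d}
    (hp : ¬ Function.Injective p) : contractFirst Ψ x p = 0 := by
  refine Finset.sum_eq_zero fun j _ => ?_
  rw [eq_zero_of_not_injective hΨ, mul_zero]
  intro h
  refine hp fun a b hab => Fin.succ_injective _ (h ?_)
  simpa using hab

theorem norm_contractFirst_comp_perm {Ψ : TensorSpace d (M + 1)}
    (hΨ : Ψ ∈ antisymmetricSubspace d (M + 1)) (x : Fin d → ℂ) (σ : Equiv.Perm (Fin M))
    (p : Fin M → Fin d) : ‖contractFirst Ψ x (p ∘ σ)‖ = ‖contractFirst Ψ x p‖ := by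
  have key : contractFirst Ψ x (p ∘ σ) =
      ((Equiv.Perm.sign σ : ℤ) : ℂ) * contractFirst Ψ x p := by
    simp only [contractFirst, Finset.mul_sum]
    refine Finset.sum_congr rfl fun j _ => ?_
    -- This permutation fixes the contracted slot 0 and acts as `σ` on the others, with the same
    -- sign.
    have h := hΨ (Equiv.Perm.decomposeFin.symm (0, σ)) (Fin.cons j p)
    have hc : (fun q => (Fin.cons j p : Fin (M + 1) → Fin d)
        (Equiv.Perm.decomposeFin.symm (0, σ) q)) = Fin.cons j (p ∘ σ) := by
      funext q
      refine Fin.cases ?_ (fun q => ?_) q <;> simp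
    rw [hc, Equiv.Perm.decomposeFin.symm_sign, if_pos rfl, one_mul] at h
    rw [h]
    ring
  rw [key, norm_mul]
  rcases Int.units_eq_one_or (Equiv.Perm.sign σ) with h | h <;> simp [h]

/-- Fixing the first entry of a symmetric nonnegative weight supported on injective tuples. -/
theorem sum_cons_le {g : (Fin (M + 1) → Fin d) → ℝ} (h0 : ∀ p, 0 ≤ g p)
    (hinj : ∀ p, ¬ Function.Injective p → g p = 0)
    (hsymm : ∀ (σ : Equiv.Perm (Fin (M + 1))) p, g (p ∘ σ) = g p) (i : Fin d) :
    ((M : ℝ) + 1) * ∑ c : Fin M → Fin d, g (Fin.cons i c) ≤ ∑ p, g p := by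
  -- By symmetry the slot holding `i` is irrelevant. Averaging over all M + 1 slots counts each
  -- injective tuple at most once.
  have h1 : ∀ k : Fin (M + 1), ∑ c : Fin M → Fin d, g (Fin.cons i c) =
      ∑ p : Fin (M + 1) → Fin d, if p k = i then g p else 0 := by
    intro k
    have e1 : ∑ p : Fin (M + 1) → Fin d, (if p k = i then g p else 0) =
        ∑ p : Fin (M + 1) → Fin d, if p 0 = i then g p else 0 := by
      refine Fintype.sum_equiv (Equiv.arrowCongr (Equiv.swap 0 k) (Equiv.refl _)) _ _ fun p => ?_
      have : (Equiv.arrowCongr (Equiv.swap 0 k) (Equiv.refl (Fin d))) p = p ∘ Equiv.swap 0 k := by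
        funext q
        simp
      rw [this, hsymm]
      simp
    rw [e1, ← (Fin.consEquiv fun _ : Fin (M + 1) => Fin d).sum_comp, Fintype.sum_prod_type,
      Finset.sum_eq_single i]
    · simp [Fin.consEquiv]
    · intro j _ hj
      simp [Fin.consEquiv, hj]
    · simp
  have h2 : ((M : ℝ) + 1) * ∑ c : Fin M → Fin d, g (Fin.cons i c) =
      ∑ k : Fin (M + 1), ∑ c : Fin M → Fin d, g (Fin.cons i c) := by
    simp
  rw [h2, Finset.sum_congr rfl fun k _ => h1 k, Finset.sum_comm]
  refine Finset.sum_le_sum fun p _ => ?_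
  by_cases hp : Function.Injective p
  · by_cases hi : ∃ k, p k = i
    · obtain ⟨k, hk⟩ := hi
      rw [Finset.sum_eq_single k]
      · simp [hk]
      · intro l _ hl
        rw [if_neg]
        exact fun h => hl (hp (h.trans hk.symm))
      · simp
    · push Not at hi
      simp [hi, h0]
  · simp [hinj p hp]

/-- The operator inequality `∑ i, aᵢ aᵢ† ≤ d - M` on `M` particles, in the form of a bound for
`∑ i, aᵢ φᵢ`. -/
theorem sum_norm_sq_sum_contractFirst_le (hM : M ≤ d) {Ψ : TensorSpace d (M + 2)}
    (hΨ : Ψ ∈ antisymmetricSubspace d (M + 2)) (x : Fin d → Fin d → ℂ) :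
    ∑ c : Fin M → Fin d, ‖∑ i, contractFirst Ψ (x i) (Fin.cons i c)‖ ^ 2 ≤
      ((d : ℝ) - M) / (M + 1) * ∑ i, ∑ p, ‖contractFirst Ψ (x i) p‖ ^ 2 := by
  have hdM : (0 : ℝ) ≤ (d : ℝ) - M := sub_nonneg.2 (by exact_mod_cast hM)
  have h1 : ∀ c : Fin M → Fin d, ‖∑ i, contractFirst Ψ (x i) (Fin.cons i c)‖ ^ 2 ≤
      ((d : ℝ) - M) * ∑ i, ‖contractFirst Ψ (x i) (Fin.cons i c)‖ ^ 2 := by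
    intro c
    by_cases hc : Function.Injective c
    -- The modes not occupied by `c`; only these d - M terms of the sum survive.
    · set s : Finset (Fin d) := (Finset.univ.image c)ᶜ with hs
      have hcard : (s.card : ℝ) = (d : ℝ) - M := by
        rw [hs, Finset.card_compl, Finset.card_image_of_injective _ hc]
        simp [Nat.cast_sub hM]
      have h2 : ∑ i, contractFirst Ψ (x i) (Fin.cons i c) =
          ∑ i ∈ s, contractFirst Ψ (x i) (Fin.cons i c) := by
        refine (Finset.sum_subset (Finset.subset_univ s) fun i _ hi => ?_).symm
        refine contractFirst_eq_zero_of_not_injective hΨ _ fun hinj => ?_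
        rw [hs, Finset.mem_compl, not_not, Finset.mem_image] at hi
        obtain ⟨k, -, hk⟩ := hi
        exact Fin.succ_ne_zero k (hinj (by simpa using hk))
      rw [h2, ← hcard]
      calc ‖∑ i ∈ s, contractFirst Ψ (x i) (Fin.cons i c)‖ ^ 2
          ≤ (∑ i ∈ s, ‖contractFirst Ψ (x i) (Fin.cons i c)‖) ^ 2 := by
            gcongr; exact norm_sum_le _ _
        _ ≤ s.card * ∑ i ∈ s, ‖contractFirst Ψ (x i) (Fin.cons i c)‖ ^ 2 :=
            sq_sum_le_card_mul_sum_sq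
        _ ≤ _ := by
            gcongr
            exact Finset.subset_univ s
    · have h2 : ∀ i, contractFirst Ψ (x i) (Fin.cons i c) = 0 := fun i => by
        refine contractFirst_eq_zero_of_not_injective hΨ _ fun hinj => hc fun a b hab => ?_
        exact Fin.succ_injective _ (hinj (by simpa using hab))
      simp [h2]
  calc _ ≤ ∑ c : Fin M → Fin d,
        ((d : ℝ) - M) * ∑ i, ‖contractFirst Ψ (x i) (Fin.cons i c)‖ ^ 2 :=
        Finset.sum_le_sum fun c _ => h1 c
    _ = ((d : ℝ) - M) * ∑ i, ∑ c : Fin M → Fin d,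
          ‖contractFirst Ψ (x i) (Fin.cons i c)‖ ^ 2 := by
        rw [← Finset.mul_sum, Finset.sum_comm]
    _ ≤ ((d : ℝ) - M) * ∑ i, (∑ p, ‖contractFirst Ψ (x i) p‖ ^ 2) / (M + 1) := by
        gcongr with i
        rw [le_div_iff₀' (by positivity)]
        refine sum_cons_le (g := fun p => ‖contractFirst Ψ (x i) p‖ ^ 2) (fun p => sq_nonneg _)
          (fun p hp => ?_) (fun σ p => ?_) i
        · simp [contractFirst_eq_zero_of_not_injective hΨ _ hp]
        · simp only [norm_contractFirst_comp_perm hΨ]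
    _ = _ := by
        rw [← Finset.sum_div]
        ring

end AntisymmetricFunctions

/-! ### The operator inequality for γ₂ and the entropy bound. -/

section ReducedDensityMatrices

variable {d N M : ℕ}

/-- Expanding the square of the contraction of Ψ with `w`; this turns operator inequalities into
norm estimates. -/
theorem reducedDensityMatrix_quadraticForm {k : ℕ} (hk : k ≤ N) (Ψ : TensorSpace d N)
    (w : (Fin k → Fin d) → ℂ) :
    ∑ a, ∑ b, star (w a) * reducedDensityMatrix k hk Ψ a b * w b =
      ((∑ c, ‖∑ a, star (w a) * Ψ (joinIndex hk a c)‖ ^ 2 : ℝ) : ℂ) := by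
  have h1 : ∀ c, ((‖∑ a, star (w a) * Ψ (joinIndex hk a c)‖ ^ 2 : ℝ) : ℂ) =
      ∑ a, ∑ b, star (w a) * (Ψ (joinIndex hk a c) * star (Ψ (joinIndex hk b c))) * w b := by
    intro c
    rw [← Complex.normSq_eq_norm_sq, ← Complex.mul_conj, map_sum, Finset.sum_mul_sum]
    refine Finset.sum_congr rfl fun a _ => Finset.sum_congr rfl fun b _ => ?_
    simp only [map_mul, starRingEnd_apply, star_star]
    ring
  symm
  rw [Complex.ofReal_sum]
  simp only [h1]
  rw [Finset.sum_comm]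
  refine Finset.sum_congr rfl fun a _ => ?_
  rw [Finset.sum_comm]
  refine Finset.sum_congr rfl fun b _ => ?_
  simp only [reducedDensityMatrix, partialTrace, ketBra, Matrix.of_apply, Finset.mul_sum,
    Finset.sum_mul]

theorem reducedDensityMatrix_isHermitian {k : ℕ} (hk : k ≤ N) (Ψ : TensorSpace d N) :
    (reducedDensityMatrix k hk Ψ).IsHermitian := by
  ext a b
  simp [reducedDensityMatrix, partialTrace, ketBra, Matrix.conjTranspose_apply, mul_comm]

theorem sum_eigenvalues_reducedDensityMatrix {k : ℕ} (hk : k ≤ N) (Ψ : TensorSpace d N)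
    (w : TensorSpace d k) :
    ∑ i, (reducedDensityMatrix_isHermitian hk Ψ).eigenvalues i *
        ‖⟪(reducedDensityMatrix_isHermitian hk Ψ).eigenvectorBasis i, w⟫_ℂ‖ ^ 2 =
      ∑ c, ‖∑ a, star (w a) * Ψ (joinIndex hk a c)‖ ^ 2 :=
  Complex.ofReal_injective <| (sum_eigenvalues_mul_norm_inner_sq _ w).trans
    (reducedDensityMatrix_quadraticForm hk Ψ w)

theorem eigenvalue_reducedDensityMatrix {k : ℕ} (hk : k ≤ N) (Ψ : TensorSpace d N)
    (i : Fin k → Fin d) :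
    (reducedDensityMatrix_isHermitian hk Ψ).eigenvalues i = ∑ c, ‖∑ a,
      star ((reducedDensityMatrix_isHermitian hk Ψ).eigenvectorBasis i a) *
        Ψ (joinIndex hk a c)‖ ^ 2 := by
  rw [← sum_eigenvalues_reducedDensityMatrix]
  rw [Finset.sum_eq_single i]
  · simp
  · intro j _ hj
    simp [hj]
  · simp

theorem eigenvalue_reducedDensityMatrix_nonneg {k : ℕ} (hk : k ≤ N) (Ψ : TensorSpace d N)
    (i : Fin k → Fin d) : 0 ≤ (reducedDensityMatrix_isHermitian hk Ψ).eigenvalues i := by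
  rw [eigenvalue_reducedDensityMatrix]
  positivity

theorem joinIndex_one (a : Fin 1 → Fin d) (p : Fin (M + 1) → Fin d) (hk : 1 ≤ M + 2) :
    joinIndex (N := M + 2) hk a p = Fin.cons (a 0) p := by
  funext q
  refine Fin.cases ?_ (fun q => ?_) q
  · exact Fin.append_left a p 0
  · have h : Fin.cast (Nat.add_sub_of_le hk).symm q.succ = Fin.natAdd 1 q := by
      ext
      simp [add_comm]
    rw [joinIndex, h, Fin.cons_succ]
    exact Fin.append_right a p q

theorem joinIndex_two (a : Fin 2 → Fin d) (c : Fin M → Fin d) (hk : 2 ≤ M + 2) :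
    joinIndex (N := M + 2) hk a c = Fin.cons (a 0) (Fin.cons (a 1) c) := by
  funext q
  refine Fin.cases ?_ (fun q => Fin.cases ?_ (fun q => ?_) q) q
  · exact Fin.append_left a c 0
  · exact Fin.append_left a c 1
  · have h : Fin.cast (Nat.add_sub_of_le hk).symm q.succ.succ = Fin.natAdd 2 q := by
      ext
      simp only [Fin.val_cast, Fin.val_succ, Fin.val_natAdd]
      omega
    rw [joinIndex, h, Fin.cons_succ, Fin.cons_succ]
    exact Fin.append_right a c q

theorem sum_eigenvalues_reducedDensityMatrix_one_eq_one (hk : 1 ≤ M + 2)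
    {Ψ : TensorSpace d (M + 2)} (hnorm : ‖Ψ‖ = 1) :
    ∑ i, (reducedDensityMatrix_isHermitian hk Ψ).eigenvalues i = 1 := by
  have h := (reducedDensityMatrix_isHermitian hk Ψ).trace_eq_sum_eigenvalues
  have h2 : (reducedDensityMatrix 1 hk Ψ).trace = ((‖Ψ‖ ^ 2 : ℝ) : ℂ) := by
    rw [EuclideanSpace.norm_sq_eq, ← (Fin.consEquiv fun _ : Fin (M + 2) => Fin d).sum_comp,
      Fintype.sum_prod_type, Matrix.trace, ← (Equiv.funUnique (Fin 1) (Fin d)).symm.sum_comp]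
    push_cast
    refine Finset.sum_congr rfl fun j _ => Finset.sum_congr rfl fun p _ => ?_
    rw [ketBra, Matrix.of_apply, joinIndex_one, ← starRingEnd_apply, Complex.mul_conj,
      Complex.normSq_eq_norm_sq]
    push_cast
    rfl
  rw [h2, hnorm] at h
  have h3 : ((∑ i, (reducedDensityMatrix_isHermitian hk Ψ).eigenvalues i : ℝ) : ℂ) =
      ((1 : ℝ) : ℂ) := by
    rw [Complex.ofReal_sum]
    simpa using h.symm
  exact Complex.ofReal_injective h3

/-- The product of the vector `x` in the first factor and the `i`-th basis vector in the second. -/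
def tensorSingle (x : TensorSpace d 1) (i : Fin d) : TensorSpace d 2 :=
  WithLp.toLp 2 fun a => x (fun _ => a 0) * if a 1 = i then 1 else 0

/-- The component of `w` along the `i`-th basis vector in the second factor. -/
def sliceSecond (w : TensorSpace d 2) (i : Fin d) : TensorSpace d 1 :=
  WithLp.toLp 2 fun b => w ![b 0, i]

theorem inner_tensorSingle (x : TensorSpace d 1) (i : Fin d) (w : TensorSpace d 2) :
    ⟪tensorSingle x i, w⟫_ℂ = ⟪x, sliceSecond w i⟫_ℂ := by
  simp only [PiLp.inner_apply, tensorSingle, sliceSecond, RCLike.inner_apply]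
  rw [← (finTwoArrowEquiv (Fin d)).symm.sum_comp, Fintype.sum_prod_type,
    ← (Equiv.funUnique (Fin 1) (Fin d)).symm.sum_comp]
  refine Finset.sum_congr rfl fun j _ => ?_
  rw [Finset.sum_eq_single i]
  · simp [finTwoArrowEquiv]
    exact Or.inl rfl
  · intro l _ hl
    simp [finTwoArrowEquiv, hl]
  · simp

theorem sliceSecond_tensorSingle (x : TensorSpace d 1) (i l : Fin d) :
    sliceSecond (tensorSingle x i) l = if l = i then x else 0 := by
  ext b
  have hb : (fun _ => b 0) = b := funext fun q => by rw [Subsingleton.elim q 0]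
  by_cases h : l = i <;> simp [sliceSecond, tensorSingle, h, hb]

theorem orthonormal_tensorSingle (u : OrthonormalBasis (Fin 1 → Fin d) ℂ (TensorSpace d 1)) :
    Orthonormal ℂ fun q : (Fin 1 → Fin d) × Fin d => tensorSingle (u q.1) q.2 := by
  rw [orthonormal_iff_ite]
  rintro ⟨k, i⟩ ⟨l, j⟩
  rw [inner_tensorSingle, sliceSecond_tensorSingle]
  split_ifs with h1 h2 h2 <;> simp_all [u.inner_eq_ite]

/-- The orthonormal basis `u k ⊗ e i` of the two-particle space. -/
noncomputable def productBasis (u : OrthonormalBasis (Fin 1 → Fin d) ℂ (TensorSpace d 1)) :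
    OrthonormalBasis ((Fin 1 → Fin d) × Fin d) ℂ (TensorSpace d 2) :=
  OrthonormalBasis.mk (orthonormal_tensorSingle u)
    ((orthonormal_tensorSingle u).linearIndependent.span_eq_top_of_card_eq_finrank'
      (by simp [sq])).ge

theorem productBasis_apply (u : OrthonormalBasis (Fin 1 → Fin d) ℂ (TensorSpace d 1))
    (q : (Fin 1 → Fin d) × Fin d) : productBasis u q = tensorSingle (u q.1) q.2 := by
  simp [productBasis]

theorem sum_joinIndex_one (hk : 1 ≤ M + 2) (Ψ : TensorSpace d (M + 2)) (x : TensorSpace d 1)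
    (p : Fin (M + 1) → Fin d) :
    ∑ a, star (x a) * Ψ (joinIndex hk a p) = contractFirst Ψ (fun j => x fun _ => j) p := by
  rw [← (Equiv.funUnique (Fin 1) (Fin d)).symm.sum_comp]
  refine Finset.sum_congr rfl fun j _ => ?_
  rw [joinIndex_one]
  rfl

/-- Contracting the first slot slice by slice leaves `i` in the second slot of Ψ, so the two-body
form becomes the sum ∑ i, aᵢ φᵢ estimated above. -/
theorem sum_joinIndex_two (hk : 2 ≤ M + 2) (Ψ : TensorSpace d (M + 2)) (w : TensorSpace d 2)
    (c : Fin M → Fin d) :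
    ∑ a, star (w a) * Ψ (joinIndex hk a c) =
      ∑ i, contractFirst Ψ (fun j => sliceSecond w i fun _ => j) (Fin.cons i c) := by
  rw [← (finTwoArrowEquiv (Fin d)).symm.sum_comp, Fintype.sum_prod_type, Finset.sum_comm]
  refine Finset.sum_congr rfl fun i _ => Finset.sum_congr rfl fun j _ => ?_
  rw [joinIndex_two]
  rfl

/-- The operator inequality `γ₂ ≤ (d - N + 2) / (N - 1) • γ₁ ⊗ 1`. -/
theorem sum_eigenvalues_two_le (h1 : 1 ≤ M + 2) (h2 : 2 ≤ M + 2) (hM : M ≤ d)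
    {Ψ : TensorSpace d (M + 2)} (hΨ : Ψ ∈ antisymmetricSubspace d (M + 2))
    (w : TensorSpace d 2) :
    ∑ i, (reducedDensityMatrix_isHermitian h2 Ψ).eigenvalues i *
        ‖⟪(reducedDensityMatrix_isHermitian h2 Ψ).eigenvectorBasis i, w⟫_ℂ‖ ^ 2 ≤
      ∑ q, ((d : ℝ) - M) / (M + 1) * (reducedDensityMatrix_isHermitian h1 Ψ).eigenvalues q.1 *
        ‖⟪productBasis (reducedDensityMatrix_isHermitian h1 Ψ).eigenvectorBasis q, w⟫_ℂ‖ ^ 2 := by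
  rw [sum_eigenvalues_reducedDensityMatrix, Fintype.sum_prod_type, Finset.sum_comm]
  simp only [productBasis_apply, inner_tensorSingle, mul_assoc, ← Finset.mul_sum,
    sum_eigenvalues_reducedDensityMatrix]
  refine le_trans (le_of_eq ?_) ((sum_norm_sq_sum_contractFirst_le hM hΨ
    fun i j => sliceSecond w i fun _ => j).trans (le_of_eq ?_))
  · exact Finset.sum_congr rfl fun c _ => by rw [← sum_joinIndex_two h2]
  · congr 1
    refine Finset.sum_congr rfl fun i _ => ?_
    exact Finset.sum_congr rfl fun p _ => by rw [← sum_joinIndex_one h1]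

/-- The partial trace of `γ₂` over the second factor is `γ₁`. -/
theorem sum_tensorSingle_two (h1 : 1 ≤ M + 2) (h2 : 2 ≤ M + 2) (Ψ : TensorSpace d (M + 2))
    (x : TensorSpace d 1) :
    ∑ i, ∑ c, ‖∑ a, star (tensorSingle x i a) * Ψ (joinIndex h2 a c)‖ ^ 2 =
      ∑ p, ‖∑ a, star (x a) * Ψ (joinIndex h1 a p)‖ ^ 2 := by
  have e : ∀ (i : Fin d) (c : Fin M → Fin d),
      ∑ a, star (tensorSingle x i a) * Ψ (joinIndex h2 a c) =
        contractFirst Ψ (fun j => x fun _ => j) (Fin.cons i c) := by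
    intro i c
    rw [sum_joinIndex_two, Finset.sum_eq_single i]
    · simp [sliceSecond_tensorSingle]
    · intro l _ hl
      simp [sliceSecond_tensorSingle, hl, contractFirst]
    · simp
  calc _ = ∑ i, ∑ c : Fin M → Fin d,
        ‖contractFirst Ψ (fun j => x fun _ => j) (Fin.cons i c)‖ ^ 2 :=
        Finset.sum_congr rfl fun i _ => Finset.sum_congr rfl fun c _ => by rw [← e]
    _ = ∑ p, ‖contractFirst Ψ (fun j => x fun _ => j) p‖ ^ 2 := by
        rw [← (Fin.consEquiv fun _ : Fin (M + 1) => Fin d).sum_comp, Fintype.sum_prod_type]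
        rfl
    _ = _ := Finset.sum_congr rfl fun p _ => by rw [← sum_joinIndex_one h1]

theorem entropy_two_ge (h1 : 1 ≤ M + 2) (h2 : 2 ≤ M + 2) (hM : M + 2 ≤ d)
    {Ψ : TensorSpace d (M + 2)} (hΨ : Ψ ∈ antisymmetricSubspace d (M + 2)) (hnorm : ‖Ψ‖ = 1) :
    vonNeumannEntropy (reducedDensityMatrix 1 h1 Ψ) - Real.log (((d : ℝ) - M) / (M + 1)) ≤
      vonNeumannEntropy (reducedDensityMatrix 2 h2 Ψ) := by
  have hC : (0 : ℝ) < ((d : ℝ) - M) / (M + 1) := by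
    have : (M : ℝ) + 2 ≤ d := by exact_mod_cast hM
    exact div_pos (by linarith) (by positivity)
  set C : ℝ := ((d : ℝ) - M) / (M + 1)
  rw [vonNeumannEntropy_eq_sum_eigenvalues (reducedDensityMatrix_isHermitian h1 Ψ),
    vonNeumannEntropy_eq_sum_eigenvalues (reducedDensityMatrix_isHermitian h2 Ψ)]
  set H1 := reducedDensityMatrix_isHermitian h1 Ψ
  set H2 := reducedDensityMatrix_isHermitian h2 Ψ
  have hν : ∀ k, 0 ≤ H1.eigenvalues k := eigenvalue_reducedDensityMatrix_nonneg h1 Ψ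
  have key := sum_mul_log_le_of_le H2.eigenvectorBasis H2.eigenvalues
    (eigenvalue_reducedDensityMatrix_nonneg h2 Ψ) (productBasis H1.eigenvectorBasis)
    (fun q => C * H1.eigenvalues q.1) (fun q => mul_nonneg hC.le (hν q.1))
    (sum_eigenvalues_two_le h1 h2 (by omega) hΨ)
  -- The logarithm does not depend on the second factor, so summing over it traces γ₂ down to γ₁.
  have hR : ∑ q, (∑ i, H2.eigenvalues i *
      ‖⟪H2.eigenvectorBasis i, productBasis H1.eigenvectorBasis q⟫_ℂ‖ ^ 2) *
        Real.log (C * H1.eigenvalues q.1) =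
      ∑ k, H1.eigenvalues k * Real.log (C * H1.eigenvalues k) := by
    rw [Fintype.sum_prod_type]
    refine Finset.sum_congr rfl fun k _ => ?_
    simp only
    rw [← Finset.sum_mul]
    congr 1
    simp only [productBasis_apply, sum_eigenvalues_reducedDensityMatrix]
    rw [sum_tensorSingle_two h1, eigenvalue_reducedDensityMatrix]
  have hlog : ∀ k, H1.eigenvalues k * Real.log (C * H1.eigenvalues k) =
      H1.eigenvalues k * Real.log C + H1.eigenvalues k * Real.log (H1.eigenvalues k) := by
    intro k
    rcases (hν k).eq_or_lt with h | h
    · simp [← h]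
    · rw [Real.log_mul hC.ne' h.ne', mul_add]
  rw [hR, Finset.sum_congr rfl fun k _ => hlog k, Finset.sum_add_distrib, ← Finset.sum_mul,
    sum_eigenvalues_reducedDensityMatrix_one_eq_one h1 hnorm, one_mul] at key
  linarith

end ReducedDensityMatrices

end Fermion

theorem theorem2 (d N : ℕ) (hN : 2 ≤ N) (hNd : N ≤ d)
    (Ψ : Fermion.TensorSpace d N) (hΨ : Ψ ∈ Fermion.antisymmetricSubspace d N)
    (hnorm : ‖Ψ‖ = 1) :
    Fermion.vonNeumannEntropy (Fermion.reducedDensityMatrix 2 hN Ψ) ≥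
      Fermion.vonNeumannEntropy (Fermion.reducedDensityMatrix 1 (one_le_two.trans hN) Ψ)
        + Real.log (((N : ℝ) - 1) / ((d : ℝ) - (N : ℝ) + 2)) := by
  obtain ⟨M, rfl⟩ := Nat.exists_eq_add_of_le' hN
  have h := Fermion.entropy_two_ge (one_le_two.trans hN) hN hNd hΨ hnorm
  have hC : (((M + 2 : ℕ) : ℝ) - 1) / ((d : ℝ) - ((M + 2 : ℕ) : ℝ) + 2) =
      (((d : ℝ) - M) / (M + 1))⁻¹ := by
    rw [inv_div]
    push_cast
    congr 1 <;> ring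
  rw [hC, Real.log_inv]
  linarith
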